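/- Let $\Omega\subset\mathbb R^2$ be a non-empty, open, bounded, convex set, $V=H_0^1(\Omega)$, and write $\|\cdot\|$, $(\cdot,\cdot)$ for the norm and inner product of $L^2(\Omega)$. For $H>0$ a coarse grid $\mathcal T^H$ of size $H$ is a finite family of pairwise disjoint, non-empty, open convex cells $K\subseteq\Omega$ covering $\Omega$ up to a null set, each contained in an axis-parallel square of side $H$, and $$V^H=\{v\in V:\ v|_K\text{ is a polynomial of degree}\le 1\text{ for all }K\in\mathcal T^H\}.$$ Let $\varkappa(x,s)$ be a (jointly measurable) conductivity and $I\subseteq\mathbb R$ a set of admissible pressure values (the basic case is $I=\mathbb R$) such that for all $x\in\Omega$ and $s,t\in I$ $$\underline\varkappa\le\varkappa(x,s)\le\overline\varkappa,\qquad |\varkappa(x,s)-\varkappa(x,t)|\le L_\varkappa|s-t|,\qquad \underline\varkappa,\,L_\varkappa>0 .$$ (For the Haverkamp conductivity $\varkappa(x,s)=\kappa(x)/(1+|s|)$ with $0<\kappa_0\le\kappa\le\kappa_1$, one takes a bounded $I$.) Put $a(p,v;u)=\int_\Omega\varkappa(x,u)\nabla p\cdot\nabla v\,dx$. For a time step $\tau>0$,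 a previous state $p_s\in L^2(\Omega)$ and a source $f_{s+1}\in L^2(\Omega)$, let $p_{s+1}\in V^H$ be a solution of the backward Euler coarse-grid problem $$\Big(\frac{p_{s+1}-p_s}{\tau},v\Big)+a(p_{s+1},v;p_{s+1})=(f_{s+1},v)\qquad\forall v\in V^H,$$ and let $p^0,p^1,p^2,\dots\in V^H$ be Picard iterates from an arbitrary guess $p^0\in V^H$, that is, $$\Big(\frac{p^{n+1}-p_s}{\tau},v\Big)+a(p^{n+1},v;p^n)=(f_{s+1},v)\qquad\forall v\in V^H,\ n\ge 0 .$$ Assume that $p_{s+1}$ and all $p^n$ take values in $I$ almost everywhere (no condition if $I=\mathbb R$), and that the discrete solution satisfies the $W^{1,\infty}$ bound $$\|\nabla p_{s+1}\|_{L^\infty(\Omega)}\le A(H+\tau)+G$$ with constants $A\ge0$, $G>0$ that do not depend on $H,\tau$ or the grid. Then: 1. The Poincaré inequality $\|v\|\le C_\Omega\|\nabla v\|$ holds for all $v\in V$ with some constant $C_\Omega>0$ depending only on $\Omega$. 2. For every such $C_\Omega$ and all $n\ge0$, $$\|p^{n+1}-p_{s+1}\|^2\le\lambda\,\|p^n-p_{s+1}\|^2,\qquad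 \lambda=\frac{C\,L_\varkappa^2}{2\underline\varkappa}\;\frac{\tau}{1+\dfrac{\tau\underline\varkappa}{2C_\Omega^2}}\;\big(\tilde C(H+\tau)+1\big)^2,\qquad C=G^2,\ \ \tilde C=A/G .$$ 3. If $\lambda<1$, then $p^n\to p_{s+1}$ in $L^2(\Omega)$ as $n\to\infty$. There is $\delta>0$, depending only on the constants in $\lambda$, such that $\lambda<1$ whenever $0<H<\delta$ and $0<\tau<\delta$; moreover $\lambda\to0$ as $H\to0^+$ and $\tau\to0^+$. 4. Statements 2 and 3 also hold, with $C=(\overline\varkappa\,G/\underline\varkappa)^2$ and $\tilde C=A/G$, for the homogenized scheme: in both problems above (hence for $p_{s+1}$ and $p^n$) the form $a$ is replaced by $\tilde a(p,v;u)=\int_\Omega\tilde\varkappa(x,u)\nabla p\cdot\nabla v\,dx$, where for $x\in K\in\mathcal T^H$ the effective tensor is $$\tilde\varkappa_{jl}(x,s)=\frac1{|K|}\int_K\varkappa(y,s)\,\frac{\partial\psi_j}{\partial y_l}\,dy ,$$ and $\psi_j$ solves the cell problem $-\operatorname{div}(\varkappa(\cdot,s)\nabla\psi_j)=0$ in $K$,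 $\psi_j=y_j$ on $\partial K$, exactly or by a Galerkin method on a fine grid; that is, $\psi_j-y_j\in W_K$ and $\int_K\varkappa(y,s)\nabla\psi_j\cdot\nabla\varphi\,dy=0$ for all $\varphi\in W_K$, where $W_K$ is a closed subspace of $H^1_0(K)$ (the same for all $s$ and $j$). -/

import Mathlib

open MeasureTheory Filter Topology
open scoped ContDiff

noncomputable section

namespace Richards

/-- The Euclidean plane. -/
abbrev Plane : Type := EuclideanSpace ℝ (Fin 2)

/-- The real Hilbert space `L²(Ω)`. -/
abbrev L2 (Ω : Set Plane) : Type := Lp ℝ 2 (volume.restrict Ω)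

/-- The real Hilbert space of square integrable vector fields on `Ω`. -/
abbrev L2Vec (Ω : Set Plane) : Type := Lp Plane 2 (volume.restrict Ω)

/-- Pairs (function, vector field) with the norm `(‖u‖² + ‖g‖²)^(1/2)`; the Sobolev spaces below
are spaces of pairs `(u, ∇u)`, so that `v.fst` is the function and `v.snd` its gradient. -/
abbrev Pair (Ω : Set Plane) : Type := WithLp 2 (L2 Ω × L2Vec Ω)

/-- Test functions, the elements of `C_c^∞(Ω)`. -/
def IsTestFunction (Ω : Set Plane) (φ : Plane → ℝ) : Prop :=
  ContDiff ℝ ∞ φ ∧ HasCompactSupport φ ∧ tsupport φ ⊆ Ω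

/-- `V = H¹₀(Ω)`: the closure of `C_c^∞(Ω)` in the `H¹`-norm, each function being stored together
with its weak gradient. -/
def H10 (Ω : Set Plane) : Submodule ℝ (Pair Ω) :=
  (Submodule.span ℝ {z : Pair Ω | ∃ φ : Plane → ℝ, IsTestFunction Ω φ ∧
    (∀ᵐ x ∂(volume.restrict Ω), z.fst x = φ x) ∧
    (∀ᵐ x ∂(volume.restrict Ω), z.snd x = gradient φ x)}).topologicalClosure

/-- `c` is a constant in the Poincaré inequality on `H¹₀(Ω)`. -/
def IsPoincareConstant (Ω : Set Plane) (c : ℝ) : Prop :=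
  0 < c ∧ ∀ v ∈ H10 Ω, ‖v.fst‖ ≤ c * ‖v.snd‖

/-- A coarse grid of size `H` on `Ω`: finitely many disjoint non-empty open convex cells
(triangles, squares, ...) that fill `Ω` up to a null set, each fitting into an axis-parallel
square of side length `H`. -/
structure IsCoarseGrid (Ω : Set Plane) (T : Set (Set Plane)) (H : ℝ) : Prop where
  finite : T.Finite
  isOpen : ∀ K ∈ T, IsOpen K
  convex : ∀ K ∈ T, Convex ℝ K
  nonempty : ∀ K ∈ T, K.Nonempty
  subset : ∀ K ∈ T, K ⊆ Ω
  disjoint : T.PairwiseDisjoint id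
  covers : volume (Ω \ ⋃₀ T) = 0
  size : ∀ K ∈ T, ∃ a : Plane, ∀ x ∈ K, ∀ i, x i ∈ Set.Icc (a i) (a i + H)

/-- The first-order Galerkin space `V^H`: the `v ∈ H¹₀(Ω)` that coincide on every cell with a
polynomial of degree at most one. -/
def P1Space (Ω : Set Plane) (T : Set (Set Plane)) : Set (Pair Ω) :=
  {v | v ∈ H10 Ω ∧ ∀ K ∈ T, ∃ (c : ℝ) (b : Plane),
    ∀ᵐ x ∂(volume.restrict K), v.fst x = c + inner ℝ b x}

/-- The form `a(p, v; u) = ∫_Ω ϰ(x, u) ∇p · ∇v dx`. -/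
def form (Ω : Set Plane) (ϰ : Plane → ℝ → ℝ) (p v u : Pair Ω) : ℝ :=
  ∫ x in Ω, ϰ x (u.fst x) * inner ℝ (p.snd x) (v.snd x)

/-- `p` solves in the space `VH` the nonlinear backward Euler problem
`((p - q)/τ, v) + a(p, v; p) = (F, v)`, with previous state `q = p_s` and source `F = f_{s+1}`. -/
def IsBackwardEuler (Ω : Set Plane) (VH : Set (Pair Ω)) (a : Pair Ω → Pair Ω → Pair Ω → ℝ)
    (τ : ℝ) (F q : L2 Ω) (p : Pair Ω) : Prop :=
  p ∈ VH ∧ ∀ v ∈ VH, inner ℝ (τ⁻¹ • (p.fst - q)) v.fst + a p v p = inner ℝ F v.fst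

/-- `p 0, p 1, ...` are Picard iterates in `VH`, from an arbitrary guess `p 0 ∈ VH`:
`((p (n+1) - q)/τ, v) + a(p (n+1), v; p n) = (F, v)`. -/
def IsPicard (Ω : Set Plane) (VH : Set (Pair Ω)) (a : Pair Ω → Pair Ω → Pair Ω → ℝ)
    (τ : ℝ) (F q : L2 Ω) (p : ℕ → Pair Ω) : Prop :=
  (∀ n, p n ∈ VH) ∧ ∀ n, ∀ v ∈ VH,
    inner ℝ (τ⁻¹ • ((p (n + 1)).fst - q)) v.fst + a (p (n + 1)) v (p n) = inner ℝ F v.fst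

/-- The function `u` takes its values in `I` (almost everywhere on `Ω`). -/
def TakesValuesIn (Ω : Set Plane) (I : Set ℝ) (u : Pair Ω) : Prop :=
  ∀ᵐ x ∂(volume.restrict Ω), u.fst x ∈ I

/-- `‖∇p‖_∞ ≤ M`. -/
def GradBound (Ω : Set Plane) (p : Pair Ω) (M : ℝ) : Prop :=
  eLpNorm (p.snd : Plane → Plane) ⊤ (volume.restrict Ω) ≤ ENNReal.ofReal M

/-- The `j`-th unit vector. -/
def unitVec (j : Fin 2) : Plane := EuclideanSpace.single j 1

/-- `w = ψ_j - x_j` for the solution `ψ_j` of the cell problem `-div(ϰ(x,s) ∇ψ_j) = 0` in `K`,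
`ψ_j = x_j` on `∂K`, posed weakly with trial and test space `W ⊆ H¹₀(K)`. -/
def IsCellCorrector (ϰ : Plane → ℝ → ℝ) (K : Set Plane) (W : Submodule ℝ (Pair K)) (s : ℝ)
    (j : Fin 2) (w : Pair K) : Prop :=
  w ∈ W ∧ ∀ φ ∈ W, ∫ x in K, ϰ x s * inner ℝ (unitVec j + w.snd x) (φ.snd x) = 0

/-- The solution `ψ_j - x_j` of the cell problem (unique, if `W` is closed and `ϰ(·,s)` is bounded
and bounded below by a positive constant). -/
def cellCorrector (ϰ : Plane → ℝ → ℝ) (K : Set Plane) (W : Submodule ℝ (Pair K)) (s : ℝ)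
    (j : Fin 2) : Pair K :=
  Classical.epsilon (IsCellCorrector ϰ K W s j)

/-- The effective tensor on a cell, with entries `(1/|K|) ∫_K ϰ(x,s) ∂ψ_j/∂x_l dx`. -/
def effectiveTensor (ϰ : Plane → ℝ → ℝ) (K : Set Plane) (W : Submodule ℝ (Pair K)) (s : ℝ) :
    Matrix (Fin 2) (Fin 2) ℝ :=
  Matrix.of fun j l => ⨍ x in K, ϰ x s * (unitVec j + (cellCorrector ϰ K W s j).snd x) l

open Classical in
/-- The homogenized coefficient `ϰ̃(x,s)`: on each cell `K` of the coarse grid it is the effective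
tensor of `K`. -/
def effectiveCoeff (ϰ : Plane → ℝ → ℝ) (T : Set (Set Plane))
    (W : (K : Set Plane) → Submodule ℝ (Pair K)) (x : Plane) (s : ℝ) :
    Matrix (Fin 2) (Fin 2) ℝ :=
  if h : ∃ K ∈ T, x ∈ K then effectiveTensor ϰ h.choose (W h.choose) s else 0

/-- The form `ã(p, v; u) = ∫_Ω ϰ̃(x, u) ∇p · ∇v dx`. -/
def homForm (Ω : Set Plane) (ϰ : Plane → ℝ → ℝ) (T : Set (Set Plane))
    (W : (K : Set Plane) → Submodule ℝ (Pair K)) (p v u : Pair Ω) : ℝ :=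
  ∫ x in Ω, inner ℝ (Matrix.toEuclideanLin (effectiveCoeff ϰ T W x (u.fst x)) (p.snd x)) (v.snd x)

/-- `λ = C L² τ (C' (H + τ) + 1)² / (2 ϰmin (1 + τ ϰmin / (2 cΩ²)))`. -/
def picardFactor (C C' L ϰmin cΩ H τ : ℝ) : ℝ :=
  C * L ^ 2 / (2 * ϰmin) * (τ / (1 + τ * ϰmin / (2 * cΩ ^ 2))) * (C' * (H + τ) + 1) ^ 2

end Richards

end

/-!
The Picard iterates for the coarse-grid backward Euler problem converge linearly because of an
energy argument, which treats both schemes at once: the scalar form and the homogenized form are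
both of the type `∫ N(x, u) ∇p · ∇v` (`tensorForm`) with a matrix field `N(x, s)` that is elliptic,
bounded and Lipschitz in `s ∈ I` (`IsEllipticFamily`).

Subtract the equation of the exact solution `p*` from that of the iterate `pⁿ⁺¹` and test with the
error `e = pⁿ⁺¹ - p*`. This gives `‖e‖²/τ + ∫ N(x, pⁿ) ∇e · ∇e = ∫ (N(x, p*) - N(x, pⁿ)) ∇p* · ∇e`,
whose right-hand side is at most `ℓ ‖∇p*‖_∞ ‖pⁿ - p*‖ ‖∇e‖`. Young's inequality absorbs half of the
gradient term and the Poincaré inequality turns the other half into `‖e‖²` (`picard_step`). The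
Poincaré inequality itself comes from `∫ φ² = -∫ 2 x₀ φ ∂₀φ` for test functions and a density
argument (`exists_isPoincareConstant`).

For the homogenized form the point is that the effective tensor inherits ellipticity with the same
constant, and Lipschitz continuity with `L` replaced by `L ϰmax / ϰmin`
(`isEllipticFamily_homCoeff`). The cell problem is solved by Lax–Milgram in `W ⊆ H¹₀(K)`. Its
solution `ψ_ξ` with boundary values `ξ · x` satisfies
`|K| ϰ̃(s) ξ · η = ∫_K ϰ(·,s) ∇ψ_η(s) · ξ`, and by Galerkin orthogonality the constant `ξ` may be
replaced by `∇ψ_ξ(t)` for any parameter `t`. With `t = s`, ellipticity follows as `∇ψ_ξ - ξ` has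
mean value zero. Together with symmetry, the increment
`|K| (ϰ̃(s) - ϰ̃(t)) ξ · η` equals `∫_K (ϰ(·,s) - ϰ(·,t)) ∇ψ_η(s) · ∇ψ_ξ(t)`, and each of the two
gradients is controlled by the minimality of its energy: `‖∇ψ_ξ‖² ≤ (ϰmax / ϰmin) |K| |ξ|²`.
-/

namespace Richards

/-! ### Test functions and the space `H¹₀` -/

/-- `z` is the pair `(φ, ∇φ)` of a test function `φ`. -/
def IsTestPair (Ω : Set Plane) (z : Pair Ω) : Prop :=
  ∃ φ : Plane → ℝ, IsTestFunction Ω φ ∧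
    (∀ᵐ x ∂(volume.restrict Ω), z.fst x = φ x) ∧
    (∀ᵐ x ∂(volume.restrict Ω), z.snd x = gradient φ x)

lemma IsTestFunction.differentiable {Ω : Set Plane} {φ : Plane → ℝ} (h : IsTestFunction Ω φ) :
    Differentiable ℝ φ :=
  h.1.differentiable (by simp)

/-- The pairs of test functions already form a linear subspace; non-linear inequalities, such as
the Poincaré inequality, can therefore be checked on them alone. -/
lemma isTestPair_of_mem_span {Ω : Set Plane} {z : Pair Ω}
    (hz : z ∈ Submodule.span ℝ {z : Pair Ω | IsTestPair Ω z}) : IsTestPair Ω z := by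
  induction hz using Submodule.span_induction with
  | mem x h => exact h
  | zero =>
    refine ⟨fun _ => 0, ⟨contDiff_const, HasCompactSupport.zero, ?_⟩, ?_, ?_⟩
    · rw [show (fun _ : Plane => (0 : ℝ)) = 0 from rfl, tsupport_zero]
      exact Set.empty_subset _
    · exact Lp.coeFn_zero ℝ 2 (volume.restrict Ω)
    · filter_upwards [Lp.coeFn_zero Plane 2 (volume.restrict Ω)] with x hx
      simpa [gradient] using hx
  | add x y _ _ hx hy =>
    obtain ⟨φ, hφ, h1, h2⟩ := hx
    obtain ⟨χ, hχ, h3, h4⟩ := hy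
    refine ⟨φ + χ, ⟨hφ.1.add hχ.1, hφ.2.1.add hχ.2.1,
      (tsupport_add φ χ).trans (Set.union_subset hφ.2.2 hχ.2.2)⟩, ?_, ?_⟩
    · filter_upwards [Lp.coeFn_add x.fst y.fst, h1, h3] with t ht h1 h3
      rw [WithLp.add_fst, ht, Pi.add_apply, Pi.add_apply, h1, h3]
    · filter_upwards [Lp.coeFn_add x.snd y.snd, h2, h4] with t ht h2 h4
      rw [WithLp.add_snd, ht, Pi.add_apply, h2, h4, gradient, gradient, gradient,
        fderiv_add (hφ.differentiable t) (hχ.differentiable t), map_add]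
  | smul c x _ hx =>
    obtain ⟨φ, hφ, h1, h2⟩ := hx
    refine ⟨c • φ, ⟨contDiff_const.smul hφ.1, hφ.2.1.smul_left (f := fun _ => c),
      (tsupport_smul_subset_right (fun _ => c) φ).trans hφ.2.2⟩, ?_, ?_⟩
    · filter_upwards [Lp.coeFn_smul c x.fst, h1] with t ht h1
      rw [WithLp.smul_fst, ht, Pi.smul_apply, Pi.smul_apply, h1]
    · filter_upwards [Lp.coeFn_smul c x.snd, h2] with t ht h2
      rw [WithLp.smul_snd, ht, Pi.smul_apply, h2, gradient, gradient,
        fderiv_const_smul (hφ.differentiable t)]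
      simp

/-- A closed property that holds for the pairs `(φ, ∇φ)` of test functions holds on `H¹₀`. -/
lemma H10_induction {Ω : Set Plane} {P : Pair Ω → Prop} (hP : IsClosed {z | P z})
    (h : ∀ z, IsTestPair Ω z → P z) {v : Pair Ω} (hv : v ∈ H10 Ω) : P v :=
  closure_minimal (fun z hz => h z (isTestPair_of_mem_span hz)) hP hv

lemma continuous_fst (Ω : Set Plane) : Continuous fun v : Pair Ω => v.fst :=
  (WithLp.fstL 2 ℝ (L2 Ω) (L2Vec Ω)).continuous

lemma continuous_snd (Ω : Set Plane) : Continuous fun v : Pair Ω => v.snd :=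
  (WithLp.sndL 2 ℝ (L2 Ω) (L2Vec Ω)).continuous

lemma IsTestFunction.integrable_mul {Ω : Set Plane} {φ : Plane → ℝ} (hφ : IsTestFunction Ω φ)
    {f : Plane → ℝ} (hf : Continuous f) : Integrable fun x => f x * φ x :=
  (hf.mul hφ.1.continuous).integrable_of_hasCompactSupport hφ.2.1.mul_left

lemma IsTestFunction.integrable_fderiv_mul {Ω : Set Plane} {φ : Plane → ℝ}
    (hφ : IsTestFunction Ω φ) {f : Plane → ℝ} (hf : Continuous f) (e : Plane) :
    Integrable fun x => f x * fderiv ℝ φ x e :=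
  (hf.mul ((hφ.1.continuous_fderiv (by simp)).clm_apply
    continuous_const)).integrable_of_hasCompactSupport (hφ.2.1.fderiv_apply (𝕜 := ℝ) e).mul_left

lemma IsTestFunction.apply_eq_zero {Ω : Set Plane} {φ : Plane → ℝ} (hφ : IsTestFunction Ω φ)
    {x : Plane} (hx : x ∉ Ω) : φ x = 0 :=
  image_eq_zero_of_notMem_tsupport fun h => hx (hφ.2.2 h)

lemma IsTestFunction.fderiv_eq_zero {Ω : Set Plane} {φ : Plane → ℝ} (hφ : IsTestFunction Ω φ)
    {x : Plane} (hx : x ∉ Ω) : fderiv ℝ φ x = 0 :=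
  fderiv_of_notMem_tsupport ℝ fun h => hx (hφ.2.2 h)

/-- Gradients of functions in `H¹₀` have mean value zero. -/
lemma inner_const_snd_eq_zero {Ω : Set Plane} [IsFiniteMeasure (volume.restrict Ω)]
    (c : Plane) {v : Pair Ω} (hv : v ∈ H10 Ω) :
    inner ℝ (Lp.const 2 (volume.restrict Ω) c) v.snd = 0 := by
  refine H10_induction (P := fun v : Pair Ω =>
    inner ℝ (Lp.const 2 (volume.restrict Ω) c) v.snd = 0) ?_ ?_ hv
  · exact isClosed_eq (continuous_const.inner (continuous_snd Ω)) continuous_const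
  · rintro z ⟨φ, hφ, -, h⟩
    rw [L2.inner_def]
    calc _ = ∫ x in Ω, fderiv ℝ φ x c := by
            refine integral_congr_ae ?_
            filter_upwards [h, Lp.coeFn_const 2 (volume.restrict Ω) c] with x h1 h2
            rw [h1, h2, Function.const_apply, real_inner_comm, inner_gradient_left]
      _ = ∫ x, fderiv ℝ φ x c :=
            setIntegral_eq_integral_of_forall_compl_eq_zero fun x hx => by
              rw [hφ.fderiv_eq_zero hx]; rfl
      _ = 0 := by
            -- Integration by parts against the constant function `1`.
            have := integral_mul_fderiv_eq_neg_fderiv_mul_of_integrable (μ := volume)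
              (f := fun _ : Plane => (1 : ℝ)) (g := φ) (v := c) (by simp)
              (hφ.integrable_fderiv_mul continuous_const c)
              (hφ.integrable_mul continuous_const)
              (fun _ _ => differentiableAt_const _) (fun x _ => hφ.differentiable x)
            simpa using this

/-- The identity `∫ φ² = -∫ 2 x₀ φ ∂₀φ`, behind the Poincaré inequality. -/
lemma IsTestFunction.integral_sq {Ω : Set Plane} {φ : Plane → ℝ} (hφ : IsTestFunction Ω φ) :
    ∫ x, φ x * φ x = ∫ x : Plane, (-2 * x 0 * φ x) * fderiv ℝ φ x (unitVec 0) := by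
  have hd : ∀ x : Plane, HasFDerivAt (fun x : Plane => x 0)
      (EuclideanSpace.proj (0 : Fin 2) : Plane →L[ℝ] ℝ) x := fun x =>
    (EuclideanSpace.proj (0 : Fin 2) : Plane →L[ℝ] ℝ).hasFDerivAt
  have hd2 : ∀ x, HasFDerivAt (fun x => φ x * φ x) (φ x • fderiv ℝ φ x + φ x • fderiv ℝ φ x) x :=
    fun x => (hφ.differentiable x).hasFDerivAt.mul (hφ.differentiable x).hasFDerivAt
  have key := integral_mul_fderiv_eq_neg_fderiv_mul_of_integrable (μ := volume)
    (f := fun x => φ x * φ x) (g := fun x : Plane => x 0) (v := unitVec 0) ?_ ?_ ?_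
    (fun x _ => (hd2 x).differentiableAt) (fun x _ => (hd x).differentiableAt)
  · have h1 : ∀ x, φ x * φ x = φ x * φ x * (fderiv ℝ (fun x : Plane => x 0) x) (unitVec 0) := by
      intro x
      rw [(hd x).fderiv]
      simp [unitVec]
    rw [integral_congr_ae (ae_of_all _ h1), key, ← integral_neg]
    refine integral_congr_ae (ae_of_all _ fun x => ?_)
    simp only [(hd2 x).fderiv]
    simp
    ring
  · refine (hφ.integrable_fderiv_mul (f := fun x => 2 * x 0 * φ x)
      (by have := hφ.1.continuous; fun_prop) (unitVec 0)).congr (ae_of_all _ fun x => ?_)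
    simp only [(hd2 x).fderiv]
    simp
    ring
  · refine (hφ.integrable_mul (f := φ) hφ.1.continuous).congr (ae_of_all _ fun x => ?_)
    simp only [(hd x).fderiv]
    simp [unitVec]
  · refine (hφ.integrable_mul (f := fun x => x 0 * φ x)
      (by have := hφ.1.continuous; fun_prop)).congr (ae_of_all _ fun x => ?_)
    simp only
    ring

lemma norm_unitVec (j : Fin 2) : ‖unitVec j‖ = 1 := by simp [unitVec]

/-- The Poincaré inequality on a bounded set. -/
lemma exists_isPoincareConstant {Ω : Set Plane} (hΩ : Bornology.IsBounded Ω)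
    (hm : MeasurableSet Ω) : ∃ c, IsPoincareConstant Ω c := by
  obtain ⟨R, hR0, hR⟩ := hΩ.exists_pos_norm_le
  refine ⟨2 * R, by positivity, fun v hv => ?_⟩
  refine H10_induction (P := fun v : Pair Ω => ‖v.fst‖ ≤ 2 * R * ‖v.snd‖) ?_ ?_ hv
  · exact isClosed_le (continuous_fst Ω).norm (continuous_const.mul (continuous_snd Ω).norm)
  rintro z ⟨φ, hφ, h1, h2⟩
  have hbound : ∀ᵐ x ∂(volume.restrict Ω),
      ‖(-2 * x 0 * z.fst x) • unitVec 0‖ ≤ 2 * R * ‖z.fst x‖ := by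
    filter_upwards [ae_restrict_mem hm] with x hx
    rw [norm_smul, norm_unitVec, mul_one, norm_mul, norm_mul]
    have : ‖x 0‖ ≤ R := (PiLp.norm_apply_le x 0).trans (hR x hx)
    have h2 : ‖(-2 : ℝ)‖ = 2 := by norm_num
    rw [h2]
    gcongr
  have hmeas : AEStronglyMeasurable (fun x : Plane => (-2 * x 0 * z.fst x) • unitVec 0)
      (volume.restrict Ω) := by
    have hc : Continuous fun x : Plane => -2 * x 0 := by fun_prop
    exact (hc.aestronglyMeasurable.mul (Lp.aestronglyMeasurable z.fst)).smul_const _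
  -- The identity for `∫ φ²` reads `‖z.fst‖² = ⟪h, z.snd⟫` with the `L²` field `h = -2 x₀ φ e₀`.
  have hmem := (Lp.memLp z.fst).of_le_mul hmeas hbound
  have hnorm : ‖hmem.toLp‖ ≤ 2 * R * ‖z.fst‖ := by
    refine Lp.norm_le_mul_norm_of_ae_le_mul ?_
    filter_upwards [hmem.coeFn_toLp, hbound] with x h1 h2
    rwa [h1]
  have hinner : ‖z.fst‖ * ‖z.fst‖ = inner ℝ hmem.toLp z.snd := by
    rw [← real_inner_self_eq_norm_mul_norm, L2.inner_def, L2.inner_def]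
    calc _ = ∫ x in Ω, φ x * φ x := by
            refine integral_congr_ae ?_
            filter_upwards [h1] with x h1
            rw [h1, real_inner_self_eq_norm_mul_norm, Real.norm_eq_abs, abs_mul_abs_self]
      _ = ∫ x, φ x * φ x := setIntegral_eq_integral_of_forall_compl_eq_zero fun x hx => by
            rw [hφ.apply_eq_zero hx, mul_zero]
      _ = ∫ x : Plane, (-2 * x 0 * φ x) * fderiv ℝ φ x (unitVec 0) := hφ.integral_sq
      _ = ∫ x : Plane in Ω, (-2 * x 0 * φ x) * fderiv ℝ φ x (unitVec 0) :=
            (setIntegral_eq_integral_of_forall_compl_eq_zero fun x hx => by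
              rw [hφ.apply_eq_zero hx, mul_zero, zero_mul]).symm
      _ = _ := by
            refine integral_congr_ae ?_
            filter_upwards [h1, h2, hmem.coeFn_toLp] with x h1 h2 h3
            rw [h3, h2, inner_smul_left, real_inner_comm, inner_gradient_left, h1]
            simp
  by_contra! hlt
  have hz : 0 < ‖z.fst‖ := lt_of_le_of_lt (by positivity) hlt
  have := (real_inner_le_norm hmem.toLp z.snd).trans
    (mul_le_mul_of_nonneg_right hnorm (norm_nonneg _))
  nlinarith

/-! ### Multiplication by bounded matrix fields -/

/-- Multiplication by a bounded measurable matrix field is a bounded operator on `L²`. -/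
lemma exists_mulOperator {S : Set Plane} {N : Plane → Plane →L[ℝ] Plane} {Λ : ℝ}
    (hN : AEStronglyMeasurable N (volume.restrict S))
    (hΛ : ∀ᵐ x ∂(volume.restrict S), ‖N x‖ ≤ Λ) :
    ∃ M : L2Vec S →L[ℝ] L2Vec S, ∀ g, ∀ᵐ x ∂(volume.restrict S), M g x = N x (g x) := by
  have hb : ∀ g : L2Vec S, ∀ᵐ x ∂(volume.restrict S), ‖N x (g x)‖ ≤ Λ * ‖g x‖ := fun g => by
    filter_upwards [hΛ] with x hx
    exact (N x).le_of_opNorm_le hx _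
  have hmem : ∀ g : L2Vec S, MemLp (fun x => N x (g x)) 2 (volume.restrict S) := fun g =>
    (Lp.memLp g).of_le_mul (isBoundedBilinearMap_apply.continuous.comp_aestronglyMeasurable
      (hN.prodMk (Lp.aestronglyMeasurable g))) (hb g)
  have hcoe : ∀ g, ∀ᵐ x ∂(volume.restrict S), (hmem g).toLp _ x = N x (g x) := fun g =>
    (hmem g).coeFn_toLp
  refine ⟨LinearMap.mkContinuous
    { toFun := fun g => (hmem g).toLp _
      map_add' := fun f g => ?_
      map_smul' := fun c g => ?_ } Λ fun g => ?_, fun g => hcoe g⟩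
  · refine Lp.ext ?_
    filter_upwards [hcoe (f + g), hcoe f, hcoe g, Lp.coeFn_add f g,
      Lp.coeFn_add ((hmem f).toLp _) ((hmem g).toLp _)] with x h1 h2 h3 h4 h5
    rw [h1, h4, h5, Pi.add_apply, Pi.add_apply, h2, h3, map_add]
  · refine Lp.ext ?_
    filter_upwards [hcoe (c • g), hcoe g, Lp.coeFn_smul c g,
      Lp.coeFn_smul c ((hmem g).toLp _)] with x h1 h2 h3 h4
    rw [h1, h3, RingHom.id_apply, h4, Pi.smul_apply, Pi.smul_apply, h2, map_smul]
  · refine Lp.norm_le_mul_norm_of_ae_le_mul ?_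
    filter_upwards [hcoe g, hb g] with x h1 h2
    exact h1 ▸ h2

lemma inner_mulOperator {S : Set Plane} {N : Plane → Plane →L[ℝ] Plane}
    {M : L2Vec S →L[ℝ] L2Vec S}
    (hM : ∀ g, ∀ᵐ x ∂(volume.restrict S), M g x = N x (g x)) (g h : L2Vec S) :
    inner ℝ (M g) h = ∫ x in S, inner ℝ (N x (g x)) (h x) := by
  rw [L2.inner_def]
  refine integral_congr_ae ?_
  filter_upwards [hM g] with x hx
  rw [hx]

/-- Pointwise ellipticity of a matrix field gives coercivity in `L²`. -/
lemma coercive_mulOperator {S : Set Plane} {N : Plane → Plane →L[ℝ] Plane} {m : ℝ}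
    {M : L2Vec S →L[ℝ] L2Vec S}
    (hM : ∀ g, ∀ᵐ x ∂(volume.restrict S), M g x = N x (g x))
    (hm : ∀ᵐ x ∂(volume.restrict S), ∀ ξ, m * ‖ξ‖ ^ 2 ≤ inner ℝ (N x ξ) ξ) (g : L2Vec S) :
    m * ‖g‖ ^ 2 ≤ inner ℝ (M g) g := by
  rw [← real_inner_self_eq_norm_sq, L2.inner_def, L2.inner_def, ← integral_const_mul]
  refine integral_mono_ae ((L2.integrable_inner (𝕜 := ℝ) g g).const_mul m)
    (L2.integrable_inner (𝕜 := ℝ) (M g) g) ?_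
  filter_upwards [hM g, hm] with x h1 h2
  simpa only [h1, real_inner_self_eq_norm_sq] using h2 (g x)

/-! ### The contraction estimate -/

/-- A family `N x s` of matrix fields, for arguments `s ∈ I`, that is elliptic with constant `m`,
bounded by `Λ` and Lipschitz in `s` with constant `ℓ`. Measurability is only asked of the
composition with an `L²` function whose values lie in `I`. -/
structure IsEllipticFamily (Ω : Set Plane) (I : Set ℝ) (N : Plane → ℝ → Plane →L[ℝ] Plane)
    (m Λ ℓ : ℝ) : Prop where
  bound : ∀ᵐ x ∂(volume.restrict Ω), ∀ s ∈ I, ‖N x s‖ ≤ Λ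
  elliptic : ∀ᵐ x ∂(volume.restrict Ω), ∀ s ∈ I, ∀ ξ, m * ‖ξ‖ ^ 2 ≤ inner ℝ (N x s ξ) ξ
  lipschitz : ∀ᵐ x ∂(volume.restrict Ω), ∀ s ∈ I, ∀ t ∈ I, ‖N x s - N x t‖ ≤ ℓ * |s - t|
  meas : ∀ u : Pair Ω, TakesValuesIn Ω I u →
    AEStronglyMeasurable (fun x => N x (u.fst x)) (volume.restrict Ω)

/-- The form `∫_Ω N(x, u) ∇p · ∇v dx`. -/
noncomputable def tensorForm (Ω : Set Plane) (N : Plane → ℝ → Plane →L[ℝ] Plane)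
    (p v u : Pair Ω) : ℝ :=
  ∫ x in Ω, inner ℝ (N x (u.fst x) (p.snd x)) (v.snd x)

lemma P1Space.sub_mem {Ω : Set Plane} {T : Set (Set Plane)} (hT : ∀ K ∈ T, K ⊆ Ω)
    {p q : Pair Ω} (hp : p ∈ P1Space Ω T) (hq : q ∈ P1Space Ω T) : p - q ∈ P1Space Ω T := by
  refine ⟨Submodule.sub_mem _ hp.1 hq.1, fun K hK => ?_⟩
  obtain ⟨c, b, h⟩ := hp.2 K hK
  obtain ⟨c', b', h'⟩ := hq.2 K hK
  refine ⟨c - c', b - b', ?_⟩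
  filter_upwards [h, h', ae_restrict_of_ae_restrict_of_subset (hT K hK)
    (Lp.coeFn_sub p.fst q.fst)] with x h1 h2 h3
  rw [WithLp.sub_fst, h3, Pi.sub_apply, h1, h2, inner_sub_left]
  ring

lemma GradBound.ae_le {Ω : Set Plane} {p : Pair Ω} {M : ℝ} (hM : 0 ≤ M) (h : GradBound Ω p M) :
    ∀ᵐ x ∂(volume.restrict Ω), ‖p.snd x‖ ≤ M := by
  rw [GradBound, eLpNorm_exponent_top] at h
  filter_upwards [ae_le_eLpNormEssSup (f := (p.snd : Plane → Plane))
    (μ := volume.restrict Ω)] with x hx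
  have := hx.trans h
  rwa [← ofReal_norm, ENNReal.ofReal_le_ofReal_iff hM] at this

/-- Absorbing `ℓMab` into half of the coercivity term, and bounding the other half from below by
the Poincaré inequality, gives the contraction factor. -/
lemma sq_le_of_energy_estimate {d e b τ m c ℓM : ℝ} (hτ : 0 < τ) (hm : 0 < m) (hc : 0 < c)
    (hd : 0 ≤ d) (hP : d ≤ c * b) (h : τ⁻¹ * d ^ 2 + m * b ^ 2 ≤ ℓM * e * b) :
    d ^ 2 ≤ ℓM ^ 2 / (2 * m) * (τ / (1 + τ * m / (2 * c ^ 2))) * e ^ 2 := by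
  have h1 : d ^ 2 / c ^ 2 ≤ b ^ 2 := by
    rw [div_le_iff₀ (by positivity)]
    nlinarith [pow_le_pow_left₀ hd hP 2]
  have h2 : ℓM * e * b ≤ ℓM ^ 2 / (2 * m) * e ^ 2 + m / 2 * b ^ 2 := by
    have h3 : ℓM ^ 2 / (2 * m) * e ^ 2 + m / 2 * b ^ 2 - ℓM * e * b
      = (ℓM * e - m * b) ^ 2 / (2 * m) := by
      field_simp
      ring
    have : 0 ≤ (ℓM * e - m * b) ^ 2 / (2 * m) := by positivity
    linarith
  have h4 : (1 + τ * m / (2 * c ^ 2)) * d ^ 2 ≤ τ * (ℓM ^ 2 / (2 * m) * e ^ 2) := by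
    have h5 : (1 + τ * m / (2 * c ^ 2)) * d ^ 2 = τ * (τ⁻¹ * d ^ 2 + m / 2 * (d ^ 2 / c ^ 2)) := by
      field_simp
    rw [h5]
    have : m / 2 * (d ^ 2 / c ^ 2) ≤ m / 2 * b ^ 2 := by gcongr
    gcongr
    linarith
  have hpos : 0 < 1 + τ * m / (2 * c ^ 2) := by positivity
  calc d ^ 2 ≤ τ * (ℓM ^ 2 / (2 * m) * e ^ 2) / (1 + τ * m / (2 * c ^ 2)) := by
        rw [le_div_iff₀ hpos]; linarith
    _ = _ := by ring

/-- One Picard step. The error equation, tested with the new error, is an energy estimate whose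
right-hand side is the change of the coefficient acting on `∇pstar`. -/
lemma picard_step {Ω : Set Plane} {I : Set ℝ} {N : Plane → ℝ → Plane →L[ℝ] Plane} {m Λ ℓ : ℝ}
    (hN : IsEllipticFamily Ω I N m Λ ℓ) (hm : 0 < m) {c τ M : ℝ} (hc : IsPoincareConstant Ω c)
    (hτ : 0 < τ) (hM : 0 ≤ M) (hℓ : 0 ≤ ℓ) {V : Set (Pair Ω)} (hV : V ⊆ H10 Ω)
    (hsub : ∀ p ∈ V, ∀ q ∈ V, p - q ∈ V) {F q : L2 Ω} {pstar p p' : Pair Ω}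
    (hpstar : IsBackwardEuler Ω V (tensorForm Ω N) τ F q pstar) (hgrad : GradBound Ω pstar M)
    (hp' : p' ∈ V) (hstep : ∀ v ∈ V,
      inner ℝ (τ⁻¹ • (p'.fst - q)) v.fst + tensorForm Ω N p' v p = inner ℝ F v.fst)
    (hIstar : TakesValuesIn Ω I pstar) (hIp : TakesValuesIn Ω I p) :
    ‖p'.fst - pstar.fst‖ ^ 2 ≤ (ℓ * M) ^ 2 / (2 * m) * (τ / (1 + τ * m / (2 * c ^ 2))) *
      ‖p.fst - pstar.fst‖ ^ 2 := by
  have bound : ∀ u, TakesValuesIn Ω I u →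
      ∀ᵐ x ∂(volume.restrict Ω), ‖N x (u.fst x)‖ ≤ Λ := fun u hu => by
    filter_upwards [hN.bound, hu] with x h1 h2 using h1 _ h2
  obtain ⟨S, hS⟩ := exists_mulOperator (hN.meas p hIp) (bound p hIp)
  obtain ⟨R, hR⟩ := exists_mulOperator (hN.meas pstar hIstar) (bound pstar hIstar)
  set v := p' - pstar with hv
  have hvV : v ∈ V := hsub _ hp' _ hpstar.1
  have e1 := hstep v hvV
  have e2 := hpstar.2 v hvV
  rw [tensorForm, ← inner_mulOperator hS] at e1
  rw [tensorForm, ← inner_mulOperator hR] at e2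
  have hcoer := coercive_mulOperator hS (m := m)
    (by filter_upwards [hN.elliptic, hIp] with x h1 h2 using h1 _ h2) v.snd
  have hdiff : ‖R pstar.snd - S pstar.snd‖ ≤ ℓ * M * ‖p.fst - pstar.fst‖ := by
    refine Lp.norm_le_mul_norm_of_ae_le_mul ?_
    filter_upwards [hN.lipschitz, hIstar, hIp, hR pstar.snd, hS pstar.snd, hgrad.ae_le hM,
      Lp.coeFn_sub (R pstar.snd) (S pstar.snd), Lp.coeFn_sub p.fst pstar.fst]
      with x h1 h2 h3 h4 h5 h6 h7 h8
    rw [h7, h8, Pi.sub_apply, Pi.sub_apply, h4, h5, ← sub_apply]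
    calc _ ≤ ℓ * |pstar.fst x - p.fst x| * ‖pstar.snd x‖ :=
          ContinuousLinearMap.le_of_opNorm_le _ (h1 _ h2 _ h3) _
      _ ≤ ℓ * |pstar.fst x - p.fst x| * M := by gcongr
      _ = _ := by rw [Real.norm_eq_abs, abs_sub_comm]; ring
  have hid : τ⁻¹ * ‖v.fst‖ ^ 2 + inner ℝ (S v.snd) v.snd
      = inner ℝ (R pstar.snd - S pstar.snd) v.snd := by
    have h1 : inner ℝ (τ⁻¹ • (p'.fst - q)) v.fst - inner ℝ (τ⁻¹ • (pstar.fst - q)) v.fst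
        = τ⁻¹ * ‖v.fst‖ ^ 2 := by
      rw [← inner_sub_left, ← smul_sub, sub_sub_sub_cancel_right, real_inner_smul_left,
        ← WithLp.sub_fst, ← hv, real_inner_self_eq_norm_sq]
    have h2 : inner ℝ (S v.snd) v.snd
        = inner ℝ (S p'.snd) v.snd - inner ℝ (S pstar.snd) v.snd := by
      rw [← inner_sub_left, ← map_sub, ← WithLp.sub_snd]
    rw [inner_sub_left, h2, ← h1]
    linarith
  refine sq_le_of_energy_estimate (b := ‖v.snd‖) hτ hm hc.1 (norm_nonneg _) ?_ ?_
  · exact hc.2 v (hV hvV)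
  · rw [← WithLp.sub_fst, ← hv]
    calc _ ≤ τ⁻¹ * ‖v.fst‖ ^ 2 + inner ℝ (S v.snd) v.snd := by gcongr
      _ = inner ℝ (R pstar.snd - S pstar.snd) v.snd := hid
      _ ≤ ‖R pstar.snd - S pstar.snd‖ * ‖v.snd‖ := real_inner_le_norm _ _
      _ ≤ _ := by gcongr

lemma tendsto_of_norm_sub_sq_le {X : Type*} [SeminormedAddCommGroup X] {u : ℕ → X} {a : X} {r : ℝ}
    (hr0 : 0 ≤ r) (hr : r < 1) (h : ∀ n, ‖u (n + 1) - a‖ ^ 2 ≤ r * ‖u n - a‖ ^ 2) :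
    Tendsto u atTop (𝓝 a) := by
  have h1 : ∀ n, ‖u n - a‖ ^ 2 ≤ r ^ n * ‖u 0 - a‖ ^ 2 := by
    intro n
    induction n with
    | zero => simp
    | succ n ih =>
      calc _ ≤ r * ‖u n - a‖ ^ 2 := h n
        _ ≤ r * (r ^ n * ‖u 0 - a‖ ^ 2) := by gcongr
        _ = _ := by ring
  have h2 : Tendsto (fun n => r ^ n * ‖u 0 - a‖ ^ 2) atTop (𝓝 0) := by
    simpa using (tendsto_pow_atTop_nhds_zero_of_lt_one hr0 hr).mul_const (‖u 0 - a‖ ^ 2)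
  have h3 := (squeeze_zero (fun n => sq_nonneg _) h1 h2).sqrt
  simp only [Real.sqrt_sq (norm_nonneg _), Real.sqrt_zero] at h3
  exact tendsto_iff_norm_sub_tendsto_zero.2 h3

lemma picardFactor_nonneg (C' L c H : ℝ) {C m τ : ℝ} (hC : 0 ≤ C) (hm : 0 ≤ m) (hτ : 0 ≤ τ) :
    0 ≤ picardFactor C C' L m c H τ := by
  unfold picardFactor
  positivity

/-- Picard iteration for an elliptic, Lipschitz family of coefficients is a contraction with the
factor `picardFactor (k G)² (A / G) L`, where `L k` is the Lipschitz constant of the family. -/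
lemma picard_contraction {Ω : Set Plane} {I : Set ℝ} {N : Plane → ℝ → Plane →L[ℝ] Plane}
    {m Λ k L A G : ℝ} (hN : IsEllipticFamily Ω I N m Λ (L * k)) (hm : 0 < m) (hL : 0 < L)
    (hk : 0 ≤ k) (hA : 0 ≤ A) (hG : 0 < G) {c H τ : ℝ} (hc : IsPoincareConstant Ω c)
    (hH : 0 < H) (hτ : 0 < τ) {T : Set (Set Plane)} (hT : ∀ K ∈ T, K ⊆ Ω)
    {F q : L2 Ω} {pstar : Pair Ω} {p : ℕ → Pair Ω}
    (hpstar : IsBackwardEuler Ω (P1Space Ω T) (tensorForm Ω N) τ F q pstar)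
    (hgrad : GradBound Ω pstar (A * (H + τ) + G))
    (hp : IsPicard Ω (P1Space Ω T) (tensorForm Ω N) τ F q p)
    (hIstar : TakesValuesIn Ω I pstar) (hIp : ∀ n, TakesValuesIn Ω I (p n)) :
    (∀ n, ‖(p (n + 1)).fst - pstar.fst‖ ^ 2 ≤
      picardFactor ((k * G) ^ 2) (A / G) L m c H τ * ‖(p n).fst - pstar.fst‖ ^ 2) ∧
    (picardFactor ((k * G) ^ 2) (A / G) L m c H τ < 1 →
      Tendsto (fun n => (p n).fst) atTop (𝓝 pstar.fst)) := by
  have key : ∀ n, ‖(p (n + 1)).fst - pstar.fst‖ ^ 2 ≤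
      picardFactor ((k * G) ^ 2) (A / G) L m c H τ * ‖(p n).fst - pstar.fst‖ ^ 2 := by
    intro n
    refine (picard_step hN hm hc hτ (by positivity) (by positivity) (fun v hv => hv.1)
      (fun _ hp _ hq => P1Space.sub_mem hT hp hq) hpstar hgrad (hp.1 (n + 1)) (hp.2 n) hIstar
      (hIp n)).trans_eq ?_
    congr 1
    rw [picardFactor, show A / G * (H + τ) + 1 = (A * (H + τ) + G) / G by field_simp]
    field_simp
  exact ⟨key, fun h => tendsto_of_norm_sub_sq_le
    (picardFactor_nonneg _ _ _ _ (sq_nonneg _) hm.le hτ.le) h key⟩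

/-! ### The contraction factor for small mesh size and time step -/

lemma tendsto_picardFactor (C C' L : ℝ) {m c : ℝ} :
    Tendsto (fun z : ℝ × ℝ => picardFactor C C' L m c z.1 z.2) (𝓝 0 ×ˢ 𝓝 0) (𝓝 0) := by
  have h : ContinuousAt (fun z : ℝ × ℝ => picardFactor C C' L m c z.1 z.2) (0, 0) := by
    unfold picardFactor
    have : (1 : ℝ) + (0, (0 : ℝ)).2 * m / (2 * c ^ 2) ≠ 0 := by simp
    fun_prop (disch := simpa using this)
  have h2 := h.tendsto
  rw [nhds_prod_eq] at h2
  simpa [picardFactor] using h2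

lemma exists_picardFactor_lt_one (C C' L m c : ℝ) :
    ∃ δ > 0, ∀ H τ : ℝ, 0 < H → H < δ → 0 < τ → τ < δ → picardFactor C C' L m c H τ < 1 := by
  have h := (tendsto_picardFactor C C' L (m := m) (c := c)).eventually (gt_mem_nhds one_pos)
  rw [← nhds_prod_eq, Metric.eventually_nhds_iff] at h
  obtain ⟨δ, hδ, h⟩ := h
  refine ⟨δ, hδ, fun H τ h1 h2 h3 h4 => h (y := (H, τ)) ?_⟩
  rw [Prod.dist_eq, max_lt_iff, Real.dist_0_eq_abs, Real.dist_0_eq_abs, abs_of_pos h1,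
    abs_of_pos h3]
  exact ⟨h2, h4⟩

lemma tendsto_picardFactor_right (C C' L m c : ℝ) :
    Tendsto (fun z : ℝ × ℝ => picardFactor C C' L m c z.1 z.2)
      (𝓝[>] 0 ×ˢ 𝓝[>] 0) (𝓝 0) :=
  (tendsto_picardFactor C C' L).mono_left (Filter.prod_mono nhdsWithin_le_nhds nhdsWithin_le_nhds)

/-! ### Scalar conductivities -/

/-- The isotropic matrix field of a scalar conductivity. -/
noncomputable def isoCoeff (ϰ : Plane → ℝ → ℝ) (x : Plane) (s : ℝ) : Plane →L[ℝ] Plane :=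
  ϰ x s • ContinuousLinearMap.id ℝ Plane

lemma norm_smul_id (a : ℝ) : ‖a • ContinuousLinearMap.id ℝ Plane‖ = |a| := by
  rw [norm_smul, ContinuousLinearMap.norm_id, mul_one, Real.norm_eq_abs]

lemma tensorForm_isoCoeff (Ω : Set Plane) (ϰ : Plane → ℝ → ℝ) :
    tensorForm Ω (isoCoeff ϰ) = form Ω ϰ := by
  funext p v u
  simp only [tensorForm, form, isoCoeff, smul_apply,
    ContinuousLinearMap.id_apply, real_inner_smul_left]

lemma isEllipticFamily_isoCoeff {Ω : Set Plane} (hΩ : MeasurableSet Ω) {ϰ : Plane → ℝ → ℝ}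
    (hϰ_meas : Measurable (Function.uncurry ϰ)) {I : Set ℝ} {m Λ L : ℝ} (hm : 0 < m)
    (hϰ_bounds : ∀ x ∈ Ω, ∀ s ∈ I, m ≤ ϰ x s ∧ ϰ x s ≤ Λ)
    (hϰ_lip : ∀ x ∈ Ω, ∀ s ∈ I, ∀ t ∈ I, |ϰ x s - ϰ x t| ≤ L * |s - t|) :
    IsEllipticFamily Ω I (isoCoeff ϰ) m Λ L where
  bound := by
    filter_upwards [ae_restrict_mem hΩ] with x hx s hs
    rw [isoCoeff, norm_smul_id, abs_of_pos (hm.trans_le (hϰ_bounds x hx s hs).1)]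
    exact (hϰ_bounds x hx s hs).2
  elliptic := by
    filter_upwards [ae_restrict_mem hΩ] with x hx s hs ξ
    rw [isoCoeff, smul_apply, ContinuousLinearMap.id_apply,
      real_inner_smul_left, real_inner_self_eq_norm_sq]
    exact mul_le_mul_of_nonneg_right (hϰ_bounds x hx s hs).1 (sq_nonneg _)
  lipschitz := by
    filter_upwards [ae_restrict_mem hΩ] with x hx s hs t ht
    have h : isoCoeff ϰ x s - isoCoeff ϰ x t =
        (ϰ x s - ϰ x t) • ContinuousLinearMap.id ℝ Plane := (sub_smul _ _ _).symm
    rw [h, norm_smul_id]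
    exact hϰ_lip x hx s hs t ht
  meas := fun u _ => by
    have h : AEMeasurable (fun x => ϰ x (u.fst x)) (volume.restrict Ω) :=
      hϰ_meas.comp_aemeasurable (aemeasurable_id.prodMk (Lp.aestronglyMeasurable u.fst).aemeasurable)
    exact h.aestronglyMeasurable.smul_const _

/-! ### The cell problems -/

/-- Constant vector fields on a cell. -/
noncomputable def constField (K : Set Plane) [IsFiniteMeasure (volume.restrict K)] :
    Plane →L[ℝ] L2Vec K :=
  Lp.constL 2 (volume.restrict K) ℝ

lemma constField_ae (K : Set Plane) [IsFiniteMeasure (volume.restrict K)] (ξ : Plane) :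
    ∀ᵐ x ∂(volume.restrict K), constField K ξ x = ξ :=
  Lp.coeFn_const 2 (volume.restrict K) ξ

lemma inner_constField_self (K : Set Plane) [IsFiniteMeasure (volume.restrict K)] (ξ : Plane) :
    inner ℝ (constField K ξ) (constField K ξ) = volume.real K * ‖ξ‖ ^ 2 := by
  rw [L2.inner_def]
  calc _ = ∫ _ in K, ‖ξ‖ ^ 2 := by
        refine integral_congr_ae ?_
        filter_upwards [constField_ae K ξ] with x hx
        rw [hx, real_inner_self_eq_norm_sq]
    _ = _ := by rw [setIntegral_const, smul_eq_mul]

/-- `∇ψ_ξ`, for the function `ψ_ξ = ∑ⱼ ξⱼ ψⱼ` which solves the cell problem with boundary values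
`x ↦ ξ · x`. -/
noncomputable def cellGradient (ϰ : Plane → ℝ → ℝ) (K : Set Plane)
    [IsFiniteMeasure (volume.restrict K)] (W : Submodule ℝ (Pair K)) (s : ℝ) (ξ : Plane) :
    L2Vec K :=
  ∑ j, ξ j • (constField K (unitVec j) + (cellCorrector ϰ K W s j).snd)

lemma sum_smul_unitVec (ξ : Plane) : ∑ j, ξ j • unitVec j = ξ := by
  ext i
  fin_cases i <;> simp [Fin.sum_univ_two, unitVec]

/-- `M` is multiplication by `ϰ(·, s)` on the vector fields over `K`. -/
def IsMulBy (ϰ : Plane → ℝ → ℝ) (K : Set Plane) (s : ℝ) (M : L2Vec K →L[ℝ] L2Vec K) : Prop :=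
  ∀ g, ∀ᵐ x ∂(volume.restrict K), M g x = ϰ x s • g x

section

variable {ϰ : Plane → ℝ → ℝ} {K : Set Plane} {W : Submodule ℝ (Pair K)} {s t : ℝ}
  {M N : L2Vec K →L[ℝ] L2Vec K} {m Λ L : ℝ}

lemma exists_isMulBy (hK : MeasurableSet K) (hϰ_meas : Measurable (Function.uncurry ϰ))
    (hm : 0 < m) (hϰ : ∀ x ∈ K, m ≤ ϰ x s ∧ ϰ x s ≤ Λ) : ∃ M, IsMulBy ϰ K s M := by
  have h : AEStronglyMeasurable (fun x => isoCoeff ϰ x s) (volume.restrict K) :=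
    (hϰ_meas.comp (measurable_id.prodMk measurable_const)).aestronglyMeasurable.smul_const _
  refine exists_mulOperator h (Λ := Λ) ?_
  filter_upwards [ae_restrict_mem hK] with x hx
  rw [isoCoeff, norm_smul_id, abs_of_pos (hm.trans_le (hϰ x hx).1)]
  exact (hϰ x hx).2

lemma IsMulBy.inner_eq (hM : IsMulBy ϰ K s M) (g h : L2Vec K) :
    inner ℝ (M g) h = ∫ x in K, ϰ x s * inner ℝ (g x) (h x) := by
  rw [inner_mulOperator (N := fun x => isoCoeff ϰ x s) hM]
  simp only [isoCoeff, smul_apply, ContinuousLinearMap.id_apply, real_inner_smul_left]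

lemma IsMulBy.symm (hM : IsMulBy ϰ K s M) (g h : L2Vec K) :
    inner ℝ (M g) h = inner ℝ (M h) g := by
  rw [hM.inner_eq, hM.inner_eq]
  simp only [real_inner_comm]

lemma IsMulBy.coercive (hM : IsMulBy ϰ K s M) (hK : MeasurableSet K)
    (hϰ : ∀ x ∈ K, m ≤ ϰ x s) (g : L2Vec K) : m * ‖g‖ ^ 2 ≤ inner ℝ (M g) g := by
  refine coercive_mulOperator (N := fun x => isoCoeff ϰ x s) hM ?_ g
  filter_upwards [ae_restrict_mem hK] with x hx ξ
  rw [isoCoeff, smul_apply, ContinuousLinearMap.id_apply, real_inner_smul_left,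
    real_inner_self_eq_norm_sq]
  exact mul_le_mul_of_nonneg_right (hϰ x hx) (sq_nonneg _)

lemma IsMulBy.norm_le (hM : IsMulBy ϰ K s M) (hK : MeasurableSet K) (hm : 0 < m)
    (hϰ : ∀ x ∈ K, m ≤ ϰ x s ∧ ϰ x s ≤ Λ) (g : L2Vec K) : ‖M g‖ ≤ Λ * ‖g‖ := by
  refine Lp.norm_le_mul_norm_of_ae_le_mul ?_
  filter_upwards [hM g, ae_restrict_mem hK] with x h hx
  rw [h, norm_smul, Real.norm_eq_abs, abs_of_pos (hm.trans_le (hϰ x hx).1)]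
  exact mul_le_mul_of_nonneg_right (hϰ x hx).2 (norm_nonneg _)

lemma IsMulBy.norm_sub_le (hM : IsMulBy ϰ K s M) (hN : IsMulBy ϰ K t N) (hK : MeasurableSet K)
    (hϰ : ∀ x ∈ K, |ϰ x s - ϰ x t| ≤ L * |s - t|) (g : L2Vec K) :
    ‖M g - N g‖ ≤ L * |s - t| * ‖g‖ := by
  refine Lp.norm_le_mul_norm_of_ae_le_mul ?_
  filter_upwards [hM g, hN g, Lp.coeFn_sub (M g) (N g), ae_restrict_mem hK] with x h1 h2 h3 hx
  rw [h3, Pi.sub_apply, h1, h2, ← sub_smul, norm_smul, Real.norm_eq_abs]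
  exact mul_le_mul_of_nonneg_right (hϰ x hx) (norm_nonneg _)

variable [IsFiniteMeasure (volume.restrict K)]

lemma isCellCorrector_iff (hM : IsMulBy ϰ K s M) {j : Fin 2} {w : Pair K} :
    IsCellCorrector ϰ K W s j w ↔
      w ∈ W ∧ ∀ φ ∈ W, inner ℝ (M (constField K (unitVec j) + w.snd)) φ.snd = 0 := by
  refine and_congr_right fun _ => forall₂_congr fun φ _ => ?_
  rw [hM.inner_eq]
  refine Eq.congr_left (integral_congr_ae ?_)
  filter_upwards [constField_ae K (unitVec j), Lp.coeFn_add (constField K (unitVec j)) w.snd]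
    with x h1 h2
  rw [h2, Pi.add_apply, h1]

/-- The cell problem is solvable, by the Lax–Milgram theorem. -/
lemma isCellCorrector_cellCorrector (hK : MeasurableSet K) (hKb : Bornology.IsBounded K)
    (hW : W ≤ H10 K) (hWc : IsClosed (W : Set (Pair K))) (hm : 0 < m)
    (hϰ : ∀ x ∈ K, m ≤ ϰ x s) (hM : IsMulBy ϰ K s M) (j : Fin 2) :
    IsCellCorrector ϰ K W s j (cellCorrector ϰ K W s j) := by
  refine Classical.epsilon_spec (p := IsCellCorrector ϰ K W s j) ?_
  obtain ⟨c, hc0, hc⟩ := exists_isPoincareConstant hKb hK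
  have : CompleteSpace W := hWc.completeSpace_coe
  let P : W →L[ℝ] L2Vec K := (WithLp.sndL 2 ℝ (L2 K) (L2Vec K)).comp W.subtypeL
  let B : W →L[ℝ] W →L[ℝ] ℝ := (innerSL ℝ).bilinearComp (M.comp P) P
  have hB : ∀ v w : W, B v w = inner ℝ (M (v : Pair K).snd) (w : Pair K).snd := fun v w => rfl
  have hcoer : IsCoercive B := by
    refine ⟨m / (1 + c ^ 2), by positivity, fun u => ?_⟩
    have h1 := hM.coercive hK hϰ (u : Pair K).snd
    have h2 : ‖u‖ * ‖u‖ ≤ (1 + c ^ 2) * ‖(u : Pair K).snd‖ ^ 2 := by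
      have h3 := WithLp.prod_norm_sq_eq_of_L2 (u : Pair K)
      have h4 := pow_le_pow_left₀ (norm_nonneg _) (hc u (hW u.2)) 2
      rw [← sq, Submodule.coe_norm, h3]
      linarith
    rw [hB]
    calc m / (1 + c ^ 2) * ‖u‖ * ‖u‖ = m / (1 + c ^ 2) * (‖u‖ * ‖u‖) := mul_assoc _ _ _
      _ ≤ m / (1 + c ^ 2) * ((1 + c ^ 2) * ‖(u : Pair K).snd‖ ^ 2) := by gcongr
      _ = m * ‖(u : Pair K).snd‖ ^ 2 := by field_simp
      _ ≤ _ := h1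
  let f : StrongDual ℝ W := -((innerSL ℝ (M (constField K (unitVec j)))).comp P)
  let w : W := hcoer.continuousLinearEquivOfBilin.symm ((InnerProductSpace.toDual ℝ W).symm f)
  refine ⟨w, (isCellCorrector_iff hM).2 ⟨w.2, fun φ hφ => ?_⟩⟩
  have h := hcoer.continuousLinearEquivOfBilin_apply w ⟨φ, hφ⟩
  rw [ContinuousLinearEquiv.apply_symm_apply, InnerProductSpace.toDual_symm_apply, hB] at h
  have hf : f ⟨φ, hφ⟩ = -inner ℝ (M (constField K (unitVec j))) φ.snd := rfl
  rw [map_add, inner_add_left, ← h, hf, add_neg_cancel]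

/-- The Galerkin orthogonality of `∇ψ_ξ`. -/
lemma inner_cellGradient_eq_zero (hM : IsMulBy ϰ K s M)
    (hw : ∀ j, IsCellCorrector ϰ K W s j (cellCorrector ϰ K W s j)) (ξ : Plane) {φ : Pair K}
    (hφ : φ ∈ W) : inner ℝ (M (cellGradient ϰ K W s ξ)) φ.snd = 0 := by
  rw [cellGradient, map_sum, sum_inner]
  refine Finset.sum_eq_zero fun j _ => ?_
  rw [map_smul, real_inner_smul_left, ((isCellCorrector_iff hM).1 (hw j)).2 φ hφ, mul_zero]

lemma exists_cellGradient_eq (hw : ∀ j, IsCellCorrector ϰ K W s j (cellCorrector ϰ K W s j))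
    (ξ : Plane) : ∃ φ ∈ W, cellGradient ϰ K W s ξ = constField K ξ + φ.snd := by
  refine ⟨∑ j, ξ j • cellCorrector ϰ K W s j,
    Submodule.sum_mem _ fun j _ => Submodule.smul_mem _ _ (hw j).1, ?_⟩
  have hc : constField K ξ =
      ξ 0 • constField K (unitVec 0) + ξ 1 • constField K (unitVec 1) := by
    rw [← map_smul, ← map_smul, ← map_add, ← Fin.sum_univ_two fun j => ξ j • unitVec j,
      sum_smul_unitVec]
  rw [cellGradient, hc, Fin.sum_univ_two, Fin.sum_univ_two, WithLp.add_snd,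
    WithLp.smul_snd, WithLp.smul_snd, smul_add, smul_add]
  abel

/-- In the energy product with `∇ψ_ξ`, the field `∇ψ_η` of any parameter value acts like the
constant `η`. -/
lemma inner_cellGradient (hM : IsMulBy ϰ K s M)
    (hs : ∀ j, IsCellCorrector ϰ K W s j (cellCorrector ϰ K W s j))
    (ht : ∀ j, IsCellCorrector ϰ K W t j (cellCorrector ϰ K W t j)) (ξ η : Plane) :
    inner ℝ (M (cellGradient ϰ K W s ξ)) (cellGradient ϰ K W t η) =
      inner ℝ (M (cellGradient ϰ K W s ξ)) (constField K η) := by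
  obtain ⟨φ, hφ, h⟩ := exists_cellGradient_eq ht η
  rw [h, inner_add_right, inner_cellGradient_eq_zero hM hs ξ hφ, add_zero]

/-- Since `∇ψ_ξ - ξ` has mean value zero, the norm of `∇ψ_ξ` is at least that of `ξ`. -/
lemma le_norm_cellGradient_sq (hW : W ≤ H10 K)
    (hs : ∀ j, IsCellCorrector ϰ K W s j (cellCorrector ϰ K W s j)) (ξ : Plane) :
    volume.real K * ‖ξ‖ ^ 2 ≤ ‖cellGradient ϰ K W s ξ‖ ^ 2 := by
  obtain ⟨φ, hφ, h⟩ := exists_cellGradient_eq hs ξ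
  have h0 : inner ℝ (constField K ξ) φ.snd = 0 := inner_const_snd_eq_zero ξ (hW hφ)
  rw [h, norm_add_sq_real, h0, ← real_inner_self_eq_norm_sq (constField K ξ),
    inner_constField_self]
  nlinarith [sq_nonneg ‖φ.snd‖]

/-- The minimality of the energy of `∇ψ_ξ` bounds its norm. -/
lemma norm_cellGradient_sq_le (hK : MeasurableSet K) (hm : 0 < m)
    (hϰ : ∀ x ∈ K, m ≤ ϰ x s ∧ ϰ x s ≤ Λ) (hM : IsMulBy ϰ K s M)
    (hs : ∀ j, IsCellCorrector ϰ K W s j (cellCorrector ϰ K W s j)) (ξ : Plane) :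
    ‖cellGradient ϰ K W s ξ‖ ^ 2 ≤ Λ / m * (volume.real K * ‖ξ‖ ^ 2) := by
  obtain ⟨φ, hφ, h⟩ := exists_cellGradient_eq hs ξ
  set g := cellGradient ϰ K W s ξ
  have h1 : m * ‖g‖ ^ 2 ≤ inner ℝ (M g) g := hM.coercive hK (fun x hx => (hϰ x hx).1) g
  have h2 : inner ℝ (M (constField K ξ)) (constField K ξ) ≤
      Λ * (volume.real K * ‖ξ‖ ^ 2) := by
    rw [← inner_constField_self, real_inner_self_eq_norm_sq]
    refine (real_inner_le_norm _ _).trans ?_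
    have := hM.norm_le hK hm hϰ (constField K ξ)
    nlinarith [norm_nonneg (constField K ξ)]
  have h3 : inner ℝ (M (constField K ξ)) (constField K ξ) =
      inner ℝ (M g) g + inner ℝ (M φ.snd) φ.snd := by
    have h4 : inner ℝ (M g) φ.snd = 0 := inner_cellGradient_eq_zero hM hs ξ hφ
    rw [eq_sub_of_add_eq h.symm, map_sub, inner_sub_left, inner_sub_right, inner_sub_right,
      hM.symm φ.snd g, h4]
    ring
  have h5 : 0 ≤ inner ℝ (M φ.snd) φ.snd :=
    (by positivity : (0 : ℝ) ≤ m * ‖φ.snd‖ ^ 2).trans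
      (hM.coercive hK (fun x hx => (hϰ x hx).1) φ.snd)
  rw [div_mul_eq_mul_div, le_div_iff₀ hm]
  linarith

lemma norm_cellGradient_mul_le (hK : MeasurableSet K) (hm : 0 < m)
    (hϰs : ∀ x ∈ K, m ≤ ϰ x s ∧ ϰ x s ≤ Λ) (hϰt : ∀ x ∈ K, m ≤ ϰ x t ∧ ϰ x t ≤ Λ)
    (hM : IsMulBy ϰ K s M) (hN : IsMulBy ϰ K t N)
    (hs : ∀ j, IsCellCorrector ϰ K W s j (cellCorrector ϰ K W s j))
    (ht : ∀ j, IsCellCorrector ϰ K W t j (cellCorrector ϰ K W t j)) (hΛ : 0 ≤ Λ) (ξ η : Plane) :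
    ‖cellGradient ϰ K W s ξ‖ * ‖cellGradient ϰ K W t η‖ ≤
      Λ / m * volume.real K * (‖ξ‖ * ‖η‖) := by
  refine le_of_sq_le_sq ?_ (by positivity)
  have h1 := norm_cellGradient_sq_le hK hm hϰs hM hs ξ
  have h2 := norm_cellGradient_sq_le hK hm hϰt hN ht η
  calc _ = ‖cellGradient ϰ K W s ξ‖ ^ 2 * ‖cellGradient ϰ K W t η‖ ^ 2 := mul_pow _ _ _
    _ ≤ _ := mul_le_mul h1 h2 (sq_nonneg _) (by positivity)
    _ = _ := by ring

/-! ### The effective tensor of a cell -/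

/-- The effective tensor as a linear map of the plane. -/
noncomputable def effectiveMap (ϰ : Plane → ℝ → ℝ) (K : Set Plane) (W : Submodule ℝ (Pair K))
    (s : ℝ) : Plane →L[ℝ] Plane :=
  LinearMap.toContinuousLinearMap (Matrix.toEuclideanLin (effectiveTensor ϰ K W s))

/-- The effective tensor is the energy product of `∇ψ_η` with the constant field `ξ`. -/
lemma inner_effectiveMap (hKpos : 0 < volume.real K) (hM : IsMulBy ϰ K s M) (ξ η : Plane) :
    volume.real K * inner ℝ (effectiveMap ϰ K W s ξ) η =
      inner ℝ (M (cellGradient ϰ K W s η)) (constField K ξ) := by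
  have hentry : ∀ j l, volume.real K * effectiveTensor ϰ K W s j l =
      inner ℝ (M (constField K (unitVec j) + (cellCorrector ϰ K W s j).snd))
        (constField K (unitVec l)) := by
    intro j l
    rw [effectiveTensor, Matrix.of_apply, setAverage_eq, smul_eq_mul,
      mul_inv_cancel_left₀ hKpos.ne', hM.inner_eq]
    refine integral_congr_ae ?_
    filter_upwards [constField_ae K (unitVec j), constField_ae K (unitVec l),
      Lp.coeFn_add (constField K (unitVec j)) (cellCorrector ϰ K W s j).snd] with x h1 h2 h3
    rw [h3, Pi.add_apply, h1, h2]
    rw [unitVec, unitVec, EuclideanSpace.inner_single_right]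
    simp
  have h : inner ℝ (effectiveMap ϰ K W s ξ) η =
      ∑ j, ∑ l, η j * ξ l * effectiveTensor ϰ K W s j l := by
    simp [effectiveMap, Matrix.toLpLin_apply, PiLp.inner_apply, Fin.sum_univ_two]
    ring
  have hξ : constField K ξ = constField K (∑ j, ξ j • unitVec j) := by rw [sum_smul_unitVec]
  rw [hξ, h, cellGradient, map_sum, map_sum, sum_inner, Finset.mul_sum]
  refine Finset.sum_congr rfl fun j _ => ?_
  rw [inner_sum, Finset.mul_sum]
  refine Finset.sum_congr rfl fun l _ => ?_
  rw [map_smul, map_smul, real_inner_smul_left, real_inner_smul_right, ← hentry]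
  ring

lemma opNorm_le_of_inner_le {f : Plane →L[ℝ] Plane} {C : ℝ} (hC : 0 ≤ C)
    (h : ∀ ξ η, inner ℝ (f ξ) η ≤ C * (‖ξ‖ * ‖η‖)) : ‖f‖ ≤ C := by
  refine f.opNorm_le_bound hC fun ξ => ?_
  have h1 := h ξ (f ξ)
  rw [real_inner_self_eq_norm_mul_norm] at h1
  rcases (norm_nonneg (f ξ)).eq_or_lt with h0 | h0
  · rw [← h0]; positivity
  · exact le_of_mul_le_mul_right (by linarith) h0

lemma le_inner_effectiveMap (hKpos : 0 < volume.real K) (hK : MeasurableSet K) (hm : 0 < m)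
    (hϰ : ∀ x ∈ K, m ≤ ϰ x s) (hM : IsMulBy ϰ K s M) (hW : W ≤ H10 K)
    (hs : ∀ j, IsCellCorrector ϰ K W s j (cellCorrector ϰ K W s j)) (ξ : Plane) :
    m * ‖ξ‖ ^ 2 ≤ inner ℝ (effectiveMap ϰ K W s ξ) ξ := by
  refine le_of_mul_le_mul_left ?_ hKpos
  rw [inner_effectiveMap hKpos hM, ← inner_cellGradient hM hs hs]
  refine le_trans ?_ (hM.coercive hK hϰ _)
  have := le_norm_cellGradient_sq hW hs ξ
  nlinarith

lemma norm_effectiveMap_le (hKpos : 0 < volume.real K) (hK : MeasurableSet K) (hm : 0 < m)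
    (hΛ : 0 ≤ Λ) (hϰ : ∀ x ∈ K, m ≤ ϰ x s ∧ ϰ x s ≤ Λ) (hM : IsMulBy ϰ K s M)
    (hs : ∀ j, IsCellCorrector ϰ K W s j (cellCorrector ϰ K W s j)) :
    ‖effectiveMap ϰ K W s‖ ≤ Λ * (Λ / m) := by
  refine opNorm_le_of_inner_le (by positivity) fun ξ η => ?_
  refine le_of_mul_le_mul_left ?_ hKpos
  rw [inner_effectiveMap hKpos hM, ← inner_cellGradient hM hs hs]
  have h1 := norm_cellGradient_mul_le hK hm hϰ hϰ hM hM hs hs hΛ η ξ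
  calc _ ≤ ‖M (cellGradient ϰ K W s η)‖ * ‖cellGradient ϰ K W s ξ‖ := real_inner_le_norm _ _
    _ ≤ Λ * ‖cellGradient ϰ K W s η‖ * ‖cellGradient ϰ K W s ξ‖ := by
        gcongr
        exact hM.norm_le hK hm hϰ _
    _ = Λ * (‖cellGradient ϰ K W s η‖ * ‖cellGradient ϰ K W s ξ‖) := by ring
    _ ≤ Λ * (Λ / m * volume.real K * (‖η‖ * ‖ξ‖)) := by gcongr
    _ = _ := by ring

/-- The effective tensor is Lipschitz in the parameter: by orthogonality and symmetry, its
increment is the integral of `(ϰ(·,s) - ϰ(·,t)) ∇ψ_η(s) · ∇ψ_ξ(t)`, without derivatives of `ψ`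
with respect to the parameter. -/
lemma norm_effectiveMap_sub_le (hKpos : 0 < volume.real K) (hK : MeasurableSet K) (hm : 0 < m)
    (hΛ : 0 ≤ Λ) (hL : 0 ≤ L) (hϰs : ∀ x ∈ K, m ≤ ϰ x s ∧ ϰ x s ≤ Λ)
    (hϰt : ∀ x ∈ K, m ≤ ϰ x t ∧ ϰ x t ≤ Λ) (hϰ : ∀ x ∈ K, |ϰ x s - ϰ x t| ≤ L * |s - t|)
    (hM : IsMulBy ϰ K s M) (hN : IsMulBy ϰ K t N)
    (hs : ∀ j, IsCellCorrector ϰ K W s j (cellCorrector ϰ K W s j))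
    (ht : ∀ j, IsCellCorrector ϰ K W t j (cellCorrector ϰ K W t j)) :
    ‖effectiveMap ϰ K W s - effectiveMap ϰ K W t‖ ≤ L * (Λ / m) * |s - t| := by
  refine opNorm_le_of_inner_le (by positivity) fun ξ η => ?_
  refine le_of_mul_le_mul_left ?_ hKpos
  have hsw : inner ℝ (N (cellGradient ϰ K W t η)) (constField K ξ) =
      inner ℝ (N (cellGradient ϰ K W s η)) (cellGradient ϰ K W t ξ) := by
    rw [← inner_cellGradient hN ht ht, hN.symm, inner_cellGradient hN ht ht,
      ← inner_cellGradient hN ht hs, hN.symm]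
  rw [sub_apply, inner_sub_left, mul_sub, inner_effectiveMap hKpos hM,
    inner_effectiveMap hKpos hN, hsw, ← inner_cellGradient hM hs ht, ← inner_sub_left]
  have h1 := norm_cellGradient_mul_le hK hm hϰs hϰt hM hN hs ht hΛ η ξ
  calc _ ≤ ‖M (cellGradient ϰ K W s η) - N (cellGradient ϰ K W s η)‖ *
        ‖cellGradient ϰ K W t ξ‖ := real_inner_le_norm _ _
    _ ≤ L * |s - t| * ‖cellGradient ϰ K W s η‖ * ‖cellGradient ϰ K W t ξ‖ := by
        gcongr
        exact hM.norm_sub_le hN hK hϰ _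
    _ = L * |s - t| * (‖cellGradient ϰ K W s η‖ * ‖cellGradient ϰ K W t ξ‖) := by ring
    _ ≤ L * |s - t| * (Λ / m * volume.real K * (‖η‖ * ‖ξ‖)) := by gcongr
    _ = _ := by ring

end

/-! ### The homogenized coefficient -/

/-- The homogenized coefficient as a family of linear maps of the plane. -/
noncomputable def homCoeff (ϰ : Plane → ℝ → ℝ) (T : Set (Set Plane))
    (W : (K : Set Plane) → Submodule ℝ (Pair K)) (x : Plane) (s : ℝ) : Plane →L[ℝ] Plane :=
  LinearMap.toContinuousLinearMap (Matrix.toEuclideanLin (effectiveCoeff ϰ T W x s))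

lemma tensorForm_homCoeff (Ω : Set Plane) (ϰ : Plane → ℝ → ℝ) (T : Set (Set Plane))
    (W : (K : Set Plane) → Submodule ℝ (Pair K)) :
    tensorForm Ω (homCoeff ϰ T W) = homForm Ω ϰ T W := rfl

lemma homCoeff_eq {T : Set (Set Plane)} (hT : T.PairwiseDisjoint id) {K : Set Plane} (hK : K ∈ T)
    {x : Plane} (hx : x ∈ K) (ϰ : Plane → ℝ → ℝ) (W : (K : Set Plane) → Submodule ℝ (Pair K))
    (s : ℝ) : homCoeff ϰ T W x s = effectiveMap ϰ K (W K) s := by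
  have h : ∃ K ∈ T, x ∈ K := ⟨K, hK, hx⟩
  have h1 : h.choose = K := hT.elim_set h.choose_spec.1 hK x h.choose_spec.2 hx
  rw [homCoeff, effectiveCoeff, dif_pos h, h1, effectiveMap]

lemma IsCoarseGrid.restrict_eq {Ω : Set Plane} {T : Set (Set Plane)} {H : ℝ}
    (hT : IsCoarseGrid Ω T H) :
    (volume : Measure Plane).restrict Ω = volume.restrict (⋃ K : T, (K : Set Plane)) := by
  rw [← Set.sUnion_eq_iUnion]
  refine Measure.restrict_congr_set ((ae_le_set.2 hT.covers).antisymm ?_)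
  exact (Set.sUnion_subset hT.subset).eventuallyLE

/-- The homogenized coefficient inherits the ellipticity constant of the conductivity, and its
Lipschitz constant up to the factor `Λ / m`. -/
lemma isEllipticFamily_homCoeff {Ω : Set Plane} (hΩb : Bornology.IsBounded Ω)
    {ϰ : Plane → ℝ → ℝ} (hϰ_meas : Measurable (Function.uncurry ϰ)) {I : Set ℝ} {m Λ L : ℝ}
    (hm : 0 < m) (hΛ : 0 ≤ Λ) (hL : 0 < L)
    (hϰ_bounds : ∀ x ∈ Ω, ∀ s ∈ I, m ≤ ϰ x s ∧ ϰ x s ≤ Λ)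
    (hϰ_lip : ∀ x ∈ Ω, ∀ s ∈ I, ∀ t ∈ I, |ϰ x s - ϰ x t| ≤ L * |s - t|)
    {T : Set (Set Plane)} {H : ℝ} (hT : IsCoarseGrid Ω T H)
    {W : (K : Set Plane) → Submodule ℝ (Pair K)}
    (hW : ∀ K ∈ T, W K ≤ H10 K ∧ IsClosed (W K : Set (Pair K))) :
    IsEllipticFamily Ω I (homCoeff ϰ T W) m (Λ * (Λ / m)) (L * (Λ / m)) := by
  have hae : ∀ᵐ x ∂(volume.restrict Ω), ∃ K ∈ T, x ∈ K := by
    rw [hT.restrict_eq, ← Set.sUnion_eq_iUnion]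
    exact ae_restrict_mem (MeasurableSet.sUnion hT.finite.countable
      fun K hK => (hT.isOpen K hK).measurableSet)
  have cell : ∀ K ∈ T, (∀ s ∈ I, ‖effectiveMap ϰ K (W K) s‖ ≤ Λ * (Λ / m)) ∧
      (∀ s ∈ I, ∀ ξ, m * ‖ξ‖ ^ 2 ≤ inner ℝ (effectiveMap ϰ K (W K) s ξ) ξ) ∧
      (∀ s ∈ I, ∀ t ∈ I, ‖effectiveMap ϰ K (W K) s - effectiveMap ϰ K (W K) t‖ ≤
        L * (Λ / m) * |s - t|) := by
    intro K hKT
    have hKm := (hT.isOpen K hKT).measurableSet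
    have hKb : Bornology.IsBounded K := hΩb.subset (hT.subset K hKT)
    have hfin : volume K ≠ ⊤ := hKb.measure_lt_top.ne
    have hpos : 0 < volume.real K :=
      ENNReal.toReal_pos ((hT.isOpen K hKT).measure_pos volume (hT.nonempty K hKT)).ne' hfin
    have : IsFiniteMeasure (volume.restrict K) := isFiniteMeasure_restrict.2 hfin
    have hb : ∀ s ∈ I, ∀ x ∈ K, m ≤ ϰ x s ∧ ϰ x s ≤ Λ := fun s hs x hx =>
      hϰ_bounds x (hT.subset K hKT hx) s hs
    have hop : ∀ s ∈ I, ∃ M, IsMulBy ϰ K s M := fun s hs =>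
      exists_isMulBy hKm hϰ_meas hm (hb s hs)
    choose! M hM using hop
    have hsol : ∀ s ∈ I, ∀ j, IsCellCorrector ϰ K (W K) s j (cellCorrector ϰ K (W K) s j) :=
      fun s hs => isCellCorrector_cellCorrector hKm hKb (hW K hKT).1 (hW K hKT).2 hm
        (fun x hx => (hb s hs x hx).1) (hM s hs)
    exact ⟨fun s hs => norm_effectiveMap_le hpos hKm hm hΛ (hb s hs) (hM s hs) (hsol s hs),
      fun s hs => le_inner_effectiveMap hpos hKm hm (fun x hx => (hb s hs x hx).1) (hM s hs)
        (hW K hKT).1 (hsol s hs),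
      fun s hs t ht => norm_effectiveMap_sub_le hpos hKm hm hΛ hL.le (hb s hs) (hb t ht)
        (fun x hx => hϰ_lip x (hT.subset K hKT hx) s hs t ht) (hM s hs) (hM t ht)
        (hsol s hs) (hsol t ht)⟩
  refine ⟨?_, ?_, ?_, fun u hu => ?_⟩
  · filter_upwards [hae] with x ⟨K, hK, hx⟩ s hs
    rw [homCoeff_eq hT.disjoint hK hx]
    exact (cell K hK).1 s hs
  · filter_upwards [hae] with x ⟨K, hK, hx⟩ s hs
    rw [homCoeff_eq hT.disjoint hK hx]
    exact (cell K hK).2.1 s hs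
  · filter_upwards [hae] with x ⟨K, hK, hx⟩ s hs t ht
    rw [homCoeff_eq hT.disjoint hK hx, homCoeff_eq hT.disjoint hK hx]
    exact (cell K hK).2.2 s hs t ht
  · have glue : ∀ f : Plane → Plane →L[ℝ] Plane,
        (∀ K ∈ T, AEStronglyMeasurable f (volume.restrict K)) →
        AEStronglyMeasurable f (volume.restrict Ω) := fun f hf => by
      have : Countable T := hT.finite.countable.to_subtype
      rw [hT.restrict_eq, aestronglyMeasurable_iUnion_iff]
      exact fun K => hf K K.2
    refine glue _ fun K hK => ?_
    -- The set `I` need not be measurable, so the tensor is extended continuously beyond it.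
    have hlip : LipschitzOnWith (L * (Λ / m)).toNNReal (effectiveMap ϰ K (W K)) I :=
      LipschitzOnWith.of_dist_le_mul fun s hs t ht => by
        rw [dist_eq_norm, Real.dist_eq, Real.coe_toNNReal _ (by positivity)]
        exact (cell K hK).2.2 s hs t ht
    obtain ⟨g, hg, hgeq⟩ := hlip.extend_finite_dimension
    have hsub := hT.subset K hK
    have hu' := ae_restrict_of_ae_restrict_of_subset hsub hu
    refine (hg.continuous.comp_aestronglyMeasurable
      ((Lp.aestronglyMeasurable u.fst).mono_measure (Measure.restrict_mono hsub le_rfl))).congr ?_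
    filter_upwards [hu', ae_restrict_mem (hT.isOpen K hK).measurableSet] with x h1 h2
    rw [homCoeff_eq hT.disjoint hK h2, hgeq h1]

end Richards

theorem mainTheorem1
    (Ω : Set Richards.Plane) (hΩ_open : IsOpen Ω) (hΩ_bdd : Bornology.IsBounded Ω)
    (hΩ_convex : Convex ℝ Ω) (hΩ_nonempty : Ω.Nonempty)
    (ϰ : Richards.Plane → ℝ → ℝ) (hϰ_meas : Measurable (Function.uncurry ϰ))
    (I : Set ℝ) (ϰmin ϰmax L : ℝ) (hϰmin : 0 < ϰmin) (hL : 0 < L)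
    (hϰ_bounds : ∀ x ∈ Ω, ∀ s ∈ I, ϰmin ≤ ϰ x s ∧ ϰ x s ≤ ϰmax)
    (hϰ_lip : ∀ x ∈ Ω, ∀ s ∈ I, ∀ t ∈ I, |ϰ x s - ϰ x t| ≤ L * |s - t|)
    (A G : ℝ) (hA : 0 ≤ A) (hG : 0 < G) :
    (∃ cΩ : ℝ, Richards.IsPoincareConstant Ω cΩ) ∧
    ∀ cΩ : ℝ, Richards.IsPoincareConstant Ω cΩ →
      -- the coarse-grid scheme with the original conductivity
      ((∀ H τ : ℝ, 0 < H → 0 < τ →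
        ∀ T : Set (Set Richards.Plane), Richards.IsCoarseGrid Ω T H →
        ∀ (F q : Richards.L2 Ω) (pstar : Richards.Pair Ω) (p : ℕ → Richards.Pair Ω),
          Richards.IsBackwardEuler Ω (Richards.P1Space Ω T) (Richards.form Ω ϰ) τ F q pstar →
          Richards.GradBound Ω pstar (A * (H + τ) + G) →
          Richards.IsPicard Ω (Richards.P1Space Ω T) (Richards.form Ω ϰ) τ F q p →
          Richards.TakesValuesIn Ω I pstar → (∀ n, Richards.TakesValuesIn Ω I (p n)) →
          (∀ n, ‖(p (n + 1)).fst - pstar.fst‖ ^ 2 ≤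
            Richards.picardFactor (G ^ 2) (A / G) L ϰmin cΩ H τ * ‖(p n).fst - pstar.fst‖ ^ 2) ∧
          (Richards.picardFactor (G ^ 2) (A / G) L ϰmin cΩ H τ < 1 →
            Filter.Tendsto (fun n => (p n).fst) Filter.atTop (nhds pstar.fst))) ∧
      (∃ δ > 0, ∀ H τ : ℝ, 0 < H → H < δ → 0 < τ → τ < δ →
        Richards.picardFactor (G ^ 2) (A / G) L ϰmin cΩ H τ < 1) ∧
      Filter.Tendsto
        (fun z : ℝ × ℝ => Richards.picardFactor (G ^ 2) (A / G) L ϰmin cΩ z.1 z.2)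
        (nhdsWithin 0 (Set.Ioi 0) ×ˢ nhdsWithin 0 (Set.Ioi 0)) (nhds 0)) ∧
      -- the coarse-grid scheme with the homogenized conductivity
      ((∀ H τ : ℝ, 0 < H → 0 < τ →
        ∀ T : Set (Set Richards.Plane), Richards.IsCoarseGrid Ω T H →
        ∀ W : (K : Set Richards.Plane) → Submodule ℝ (Richards.Pair K),
          (∀ K ∈ T, W K ≤ Richards.H10 K ∧ IsClosed (W K : Set (Richards.Pair K))) →
        ∀ (F q : Richards.L2 Ω) (pstar : Richards.Pair Ω) (p : ℕ → Richards.Pair Ω),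
          Richards.IsBackwardEuler Ω (Richards.P1Space Ω T) (Richards.homForm Ω ϰ T W)
            τ F q pstar →
          Richards.GradBound Ω pstar (A * (H + τ) + G) →
          Richards.IsPicard Ω (Richards.P1Space Ω T) (Richards.homForm Ω ϰ T W) τ F q p →
          Richards.TakesValuesIn Ω I pstar → (∀ n, Richards.TakesValuesIn Ω I (p n)) →
          (∀ n, ‖(p (n + 1)).fst - pstar.fst‖ ^ 2 ≤
            Richards.picardFactor ((ϰmax / ϰmin * G) ^ 2) (A / G) L ϰmin cΩ H τ *
              ‖(p n).fst - pstar.fst‖ ^ 2) ∧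
          (Richards.picardFactor ((ϰmax / ϰmin * G) ^ 2) (A / G) L ϰmin cΩ H τ < 1 →
            Filter.Tendsto (fun n => (p n).fst) Filter.atTop (nhds pstar.fst))) ∧
      (∃ δ > 0, ∀ H τ : ℝ, 0 < H → H < δ → 0 < τ → τ < δ →
        Richards.picardFactor ((ϰmax / ϰmin * G) ^ 2) (A / G) L ϰmin cΩ H τ < 1) ∧
      Filter.Tendsto
        (fun z : ℝ × ℝ =>
          Richards.picardFactor ((ϰmax / ϰmin * G) ^ 2) (A / G) L ϰmin cΩ z.1 z.2)
        (nhdsWithin 0 (Set.Ioi 0) ×ˢ nhdsWithin 0 (Set.Ioi 0)) (nhds 0)) := by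
  obtain ⟨c₀, hc₀⟩ := Richards.exists_isPoincareConstant hΩ_bdd hΩ_open.measurableSet
  refine ⟨⟨c₀, hc₀⟩, fun cΩ hcΩ => ⟨⟨?_, Richards.exists_picardFactor_lt_one _ _ _ _ _,
    Richards.tendsto_picardFactor_right _ _ _ _ _⟩, ⟨?_,
    Richards.exists_picardFactor_lt_one _ _ _ _ _,
    Richards.tendsto_picardFactor_right _ _ _ _ _⟩⟩⟩
  · intro H τ hH hτ T hT F q pstar p hpstar hgrad hp hIstar hIp
    rw [← Richards.tensorForm_isoCoeff] at hpstar hp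
    have hN := Richards.isEllipticFamily_isoCoeff hΩ_open.measurableSet hϰ_meas hϰmin
      hϰ_bounds hϰ_lip
    rw [← mul_one L] at hN
    have h := Richards.picard_contraction hN hϰmin hL zero_le_one hA hG hcΩ hH hτ hT.subset
      hpstar hgrad hp hIstar hIp
    rwa [one_mul] at h
  · intro H τ hH hτ T hT W hW F q pstar p hpstar hgrad hp hIstar hIp
    rw [← Richards.tensorForm_homCoeff] at hpstar hp
    -- As `Ω` has positive measure, `pstar` attains some value in `I`, whence `0 ≤ ϰmax`.
    have hϰmax : 0 ≤ ϰmax := by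
      have : NeZero (volume.restrict Ω) :=
        ⟨fun h => (hΩ_open.measure_pos volume hΩ_nonempty).ne' (Measure.restrict_eq_zero.1 h)⟩
      obtain ⟨x, hxI, hx⟩ := (hIstar.and (ae_restrict_mem hΩ_open.measurableSet)).exists
      obtain ⟨h1, h2⟩ := hϰ_bounds x hx _ hxI
      exact hϰmin.le.trans (h1.trans h2)
    exact Richards.picard_contraction
      (Richards.isEllipticFamily_homCoeff hΩ_bdd hϰ_meas hϰmin hϰmax hL hϰ_bounds hϰ_lip hT hW)
      hϰmin hL (by positivity) hA hG hcΩ hH hτ hT.subset hpstar hgrad hp hIstar hIp
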